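/- Let $\mathfrak H=\mathfrak H_1\oplus\mathfrak H_2$ be an orthogonal decomposition of a complex Hilbert space into closed subspaces. For a bounded selfadjoint operator $A$ let $\nu_-(A)\in\{0,1,2,\dots,\infty\}$ be the supremum of the dimensions of the subspaces $\mathfrak L$ with $(Af,f)<0$ for all $f\in\mathfrak L\setminus\{0\}$, and let $|A|=(A^*A)^{1/2}$. Let $T_1:\mathfrak H_1\to\mathfrak H$ be a bounded operator that is symmetric, i.e. $(T_1f,g)=(f,T_1g)$ for all $f,g\in\mathfrak H_1$, let $T_{11}=P_{\mathfrak H_1}T_1$, and assume that $$\nu_-(I-T_{11}^2)=\nu_-(I-T_1^*T_1)<\infty .$$ Then among the bounded selfadjoint extensions $T$ of $T_1$ to $\mathfrak H$ with $\nu_-(I+T)=\nu_-(I+T_{11})$ there is a smallest one, $T_m$; among those with $\nu_-(I-T)=\nu_-(I-T_{11})$ there is a largest one, $T_M$; and $T_m=T_M$ if and only if $$\sup_{f\in\mathfrak H_1}\frac{|(T_1f,\varphi)|^2}{(|I-T_1^*T_1|f,f)}=\infty\qquad\text{for every }\varphi\in\mathfrak H_2\setminus\{0\},$$ where in the quotient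 $0/0=0$ and $a/0=\infty$ for $a>0$. -/

import Mathlib

noncomputable section

open scoped InnerProductSpace

/-- The negative index `ν₋(A)` of a bounded selfadjoint operator: the supremum of the dimensions of
the `A`-negative subspaces `L`, i.e. those with `(A f, f) < 0` for all nonzero `f ∈ L`
(`⊤` if there is no finite bound). -/
def negIndex {E : Type*} [NormedAddCommGroup E] [InnerProductSpace ℂ E] (A : E →L[ℂ] E) : ℕ∞ :=
  ⨆ (L : Submodule ℂ E) (_ : ∀ f ∈ L, f ≠ 0 → (⟪A f, f⟫_ℂ).re < 0),
    Cardinal.toENat (Module.rank ℂ L)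

/-- The modulus `|C| = (C* C)^{1/2}` of a bounded operator in a Hilbert space. -/
def modulus {E : Type*} [NormedAddCommGroup E] [InnerProductSpace ℂ E] [CompleteSpace E]
    (C : E →L[ℂ] E) : E →L[ℂ] E :=
  CFC.sqrt (star C * C)

section Extension

variable {H : Type*} [NormedAddCommGroup H] [InnerProductSpace ℂ H]
  {H₁ : Submodule ℂ H} [CompleteSpace H₁]

/-- A bounded operator `T₁ : 𝔥₁ → 𝔥` defined on a subspace `𝔥₁` of `𝔥` is symmetric. -/
def IsSymmetricOn (T₁ : H₁ →L[ℂ] H) : Prop :=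
  ∀ f g : H₁, ⟪T₁ f, (g : H)⟫_ℂ = ⟪(f : H), T₁ g⟫_ℂ

/-- The corner `C₁₁ = P C : 𝔥₁ → 𝔥₁` of a column `C = col(C₁₁, C₂₁) : 𝔥₁ → 𝔥₁ ⊕ 𝔥₂`, where
`𝔥₂ = 𝔥₁ᗮ` and `P` is the orthogonal projection onto `𝔥₁`. -/
def corner (C : H₁ →L[ℂ] H) : H₁ →L[ℂ] H₁ :=
  H₁.orthogonalProjectionOnto ∘L C

variable [CompleteSpace H]

/-- The solutions of the completion problem under the minimal index condition for the incomplete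
block operator `(C₁₁, C₂₁*; C₂₁, *)` with first column `C : 𝔥₁ → 𝔥`: the bounded
selfadjoint operators `A` in `𝔥` with first column `C` and `ν₋(A) = ν₋(C₁₁)`. -/
def completions (C : H₁ →L[ℂ] H) : Set (H →L[ℂ] H) :=
  {A | IsSelfAdjoint A ∧ (∀ f : H₁, A f = C f) ∧ negIndex A = negIndex (corner C)}

/-- `Tm = A₊ - I`, where `A₊` is the smallest solution (in the usual order of bounded selfadjoint
operators) of the completion problem for `(I + T₁₁, T₂₁*; T₂₁, *)`. -/
def IsMinimalExtension (T₁ : H₁ →L[ℂ] H) (Tm : H →L[ℂ] H) : Prop :=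
  IsLeast (completions (H₁.subtypeL + T₁)) (1 + Tm)

/-- `TM = I - A₋`, where `A₋` is the smallest solution of the completion problem for
`(I - T₁₁, -T₂₁*; -T₂₁, *)`. -/
def IsMaximalExtension (T₁ : H₁ →L[ℂ] H) (TM : H →L[ℂ] H) : Prop :=
  IsLeast (completions (H₁.subtypeL - T₁)) (1 - TM)

/-- The operator `I - T₁* T₁` in `𝔥₁`. -/
def defect (T₁ : H₁ →L[ℂ] H) : H₁ →L[ℂ] H₁ :=
  1 - T₁.adjoint ∘L T₁

/-- `sup_{f ∈ 𝔥₁} |(T₁ f, φ)|² / (|I - T₁* T₁| f, f)`, as an element of `[0, ∞]`, where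
`0 / 0 = 0` and `a / 0 = ∞` for `a > 0`. It is `∞` iff there is no finite constant `c` with
`|(T₁ f, φ)|² ≤ c (|I - T₁* T₁| f, f)` for all `f ∈ 𝔥₁`. -/
def kreinSup (T₁ : H₁ →L[ℂ] H) (φ : H) : ENNReal :=
  ⨆ f : H₁, ENNReal.ofReal (‖⟪T₁ f, φ⟫_ℂ‖ ^ 2) /
    ENNReal.ofReal (⟪modulus (defect T₁) f, f⟫_ℂ).re

end Extension

end

/-! Put t = T₁₁ and D = I − T₁*T₁. Then D = (I − t²) − b*b with b = T₂₁, so equality of the indices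
forces ‖b f‖² ≤ c(|I − t²|f, f) (`exists_norm_sq_le_modulus`). Since I − t² = a(2 − a) for a = I +
t, also ‖b f‖² ≤ c'(|a|f, f).

Factor a = pJp with p = |a|^{1/2} and J = 1 − 2P a reflection of finite negative rank. The bound
gives b = Rp, and A = G*JG with G = (p, JR*) solves the completion problem for I + T₁
(`exists_completion_hasNullSequences`). Along suitable sequences in 𝔥₁ + ψ, both A and its form tend
to zero; this forces A to be the smallest solution (`isLeast_of_hasNullSequences`). Replacing T₁ by
−T₁ gives T_M.

For the criterion, half the sum of the null sequences of I + T_m at ψ and of I − T_M at −ψ is a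
sequence f with D f → −T₁*w, where w = ½(T_M − T_m)ψ, with (D f, f) convergent and P₂T₁f → w − ψ
weakly (`exists_sequence`). If w = 0, these f show that the supremum at ψ is infinite. If w ≠ 0,
Cauchy–Schwarz for D bounds |(T₁g, w)|² by a multiple of (|D|g, g), so the supremum at w is finite.
-/

open scoped InnerProductSpace

open Filter Topology

/-! ### Negative index and maximal negative subspaces -/

section NegIndex

variable {E : Type*} [NormedAddCommGroup E] [InnerProductSpace ℂ E]

/-- A subspace is `A`-negative if `(A f, f) < 0` for all its nonzero elements. -/
def IsNegativeOn (A : E →L[ℂ] E) (L : Submodule ℂ E) : Prop :=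
  ∀ f ∈ L, f ≠ 0 → (⟪A f, f⟫_ℂ).re < 0

theorem IsNegativeOn.toENat_rank_le_negIndex {A : E →L[ℂ] E} {L : Submodule ℂ E}
    (h : IsNegativeOn A L) : Cardinal.toENat (Module.rank ℂ L) ≤ negIndex A :=
  le_iSup₂ (f := fun (L : Submodule ℂ E) (_ : ∀ f ∈ L, f ≠ 0 → (⟪A f, f⟫_ℂ).re < 0) ↦
    Cardinal.toENat (Module.rank ℂ L)) L h

theorem toENat_rank_eq_finrank (L : Submodule ℂ E) [FiniteDimensional ℂ L] :
    Cardinal.toENat (Module.rank ℂ L) = Module.finrank ℂ L := by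
  rw [← Module.finrank_eq_rank, Cardinal.toENat_nat]

theorem IsNegativeOn.finrank_le_negIndex {A : E →L[ℂ] E} {L : Submodule ℂ E}
    [FiniteDimensional ℂ L] (h : IsNegativeOn A L) :
    (Module.finrank ℂ L : ℕ∞) ≤ negIndex A :=
  toENat_rank_eq_finrank L ▸ h.toENat_rank_le_negIndex

theorem IsNegativeOn.finiteDimensional {A : E →L[ℂ] E} {L : Submodule ℂ E}
    (h : IsNegativeOn A L) (hA : negIndex A < ⊤) : FiniteDimensional ℂ L := by
  have h1 := h.toENat_rank_le_negIndex.trans_lt hA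
  rw [Cardinal.toENat_lt_top] at h1
  exact Module.rank_lt_aleph0_iff.1 h1

/-- If `(A f, f) ≥ 0` whenever `Q f = 0`, then `ν₋(A)` is at most the rank of `Q`. -/
theorem negIndex_le_rank_range {F : Type*} [NormedAddCommGroup F] [InnerProductSpace ℂ F]
    {A : E →L[ℂ] E} (Q : E →L[ℂ] F) [FiniteDimensional ℂ Q.range]
    (h : ∀ f, Q f = 0 → 0 ≤ (⟪A f, f⟫_ℂ).re) :
    negIndex A ≤ Module.finrank ℂ Q.range := by
  refine iSup₂_le fun L hL ↦ ?_
  have hinj : Function.Injective ((Q : E →ₗ[ℂ] F).rangeRestrict ∘ₗ L.subtype) := by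
    rw [← LinearMap.ker_eq_bot, LinearMap.ker_eq_bot']
    intro f hf
    by_contra hne
    have h0 : Q f = 0 := congrArg Subtype.val hf
    exact absurd (h f h0) (not_le.2 (hL f f.2 (by simpa using hne)))
  have : FiniteDimensional ℂ L := Module.Finite.of_injective _ hinj
  rw [toENat_rank_eq_finrank]
  exact_mod_cast LinearMap.finrank_le_finrank_of_injective hinj

/-- A finite-dimensional negative subspace of maximal dimension is maximal. -/
theorem IsNegativeOn.exists_nonneg {A : E →L[ℂ] E} {L : Submodule ℂ E}
    [FiniteDimensional ℂ L] (h : IsNegativeOn A L)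
    (hdim : negIndex A ≤ Module.finrank ℂ L) (k : E) :
    ∃ r ∈ L, 0 ≤ (⟪A (k + r), k + r⟫_ℂ).re := by
  by_contra! hneg
  have hk : k ∉ L := fun hk ↦ by simpa using hneg (-k) (L.neg_mem hk)
  have hL : IsNegativeOn A (L ⊔ ℂ ∙ k) := by
    intro f hf hf0
    obtain ⟨r, hr, s, hs, rfl⟩ := Submodule.mem_sup.1 hf
    obtain ⟨α, rfl⟩ := Submodule.mem_span_singleton.1 hs
    rcases eq_or_ne α 0 with rfl | hα
    · simpa using h r hr (by simpa using hf0)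
    · have h1 : r + α • k = α • (k + α⁻¹ • r) := by
        rw [smul_add, smul_smul, mul_inv_cancel₀ hα, one_smul, add_comm]
      have h2 := hneg _ (L.smul_mem α⁻¹ hr)
      rw [h1, map_smul, inner_smul_left, inner_smul_right, ← mul_assoc, Complex.conj_mul']
      rw [← Complex.ofReal_pow, Complex.re_ofReal_mul]
      have : 0 < ‖α‖ ^ 2 := by positivity
      exact mul_neg_of_pos_of_neg this h2
  have h1 := hL.finrank_le_negIndex.trans hdim
  have hk0 : k ≠ 0 := fun h0 ↦ hk (h0 ▸ L.zero_mem)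
  have hlt : L < L ⊔ ℂ ∙ k := by
    refine lt_of_le_of_ne le_sup_left fun he ↦ hk ?_
    rw [he]
    exact Submodule.mem_sup_right (Submodule.mem_span_singleton_self k)
  exact absurd (Submodule.finrank_lt_finrank_of_lt hlt) (not_lt.2 (by exact_mod_cast h1))

theorem re_inner_apply_nonneg {b : E →L[ℂ] E} (hb : 0 ≤ b) (x : E) : 0 ≤ (⟪b x, x⟫_ℂ).re :=
  ((ContinuousLinearMap.nonneg_iff_isPositive b).1 hb).re_inner_nonneg_left x

end NegIndex

/-! ### Factorization of an operator with finitely many negative squares -/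

section Signature

variable {K : Type*} [NormedAddCommGroup K] [InnerProductSpace ℂ K] [CompleteSpace K]

/-- `p = |a|^{1/2}`, and `P` is the projection of finite rank `ν₋(a)` onto the negative spectral
subspace of `a`, so that `a = p (1 - 2 P) p`. -/
structure Signature (a p P : K →L[ℂ] K) : Prop where
  symm_root : ∀ x y, ⟪p x, y⟫_ℂ = ⟪x, p y⟫_ℂ
  symm_proj : ∀ x y, ⟪P x, y⟫_ℂ = ⟪x, P y⟫_ℂ
  idem : ∀ x, P (P x) = P x
  comm : ∀ x, P (p x) = p (P x)
  sq : ∀ x, p (p x) = modulus a x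
  fac : ∀ x, a x = p (p x) - (2 : ℂ) • p (P (p x))
  fin : FiniteDimensional ℂ P.range
  finrank_eq : negIndex a = Module.finrank ℂ P.range
  gap : ∃ δ > 0, ∀ x, δ * ‖P x‖ ^ 2 ≤ ‖p (P x)‖ ^ 2

theorem negPart_comp_apply_negPart {a : K →L[ℂ] K} (ha : IsSelfAdjoint a) (x : K) :
    a (a⁻ x) = - a⁻ (a⁻ x) := by
  have h1 : a * a⁻ = - (a⁻ * a⁻) := by
    have h2 : (a⁺ - a⁻) * a⁻ = -(a⁻ * a⁻) := by simp [sub_mul]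
    rwa [CFC.posPart_sub_negPart a ha] at h2
  simpa using congrArg (fun T : K →L[ℂ] K ↦ T x) h1

theorem inner_negPart_left (a : K →L[ℂ] K) (x y : K) : ⟪a⁻ x, y⟫_ℂ = ⟪x, a⁻ y⟫_ℂ :=
  (IsSelfAdjoint.of_nonneg (CFC.negPart_nonneg a)).isSymmetric x y

theorem ker_of_inner_eq_zero {b : K →L[ℂ] K} (hb : 0 ≤ b) {x : K} (h : (⟪b x, x⟫_ℂ).re = 0) :
    b x = 0 := by
  have hs : ∀ x y, ⟪CFC.sqrt b x, y⟫_ℂ = ⟪x, CFC.sqrt b y⟫_ℂ :=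
    (IsSelfAdjoint.of_nonneg (CFC.sqrt_nonneg b)).isSymmetric
  have h1 : b x = CFC.sqrt b (CFC.sqrt b x) := by
    conv_lhs => rw [← CFC.sqrt_mul_sqrt_self b hb]
    rfl
  have h2 : CFC.sqrt b x = 0 := by
    rw [h1, hs, ← RCLike.re_eq_complex_re, inner_self_eq_norm_sq] at h
    simpa using h
  rw [h1, h2, map_zero]

theorem negPart_negPart_eq_zero {a : K →L[ℂ] K} {x : K} (h : a⁻ (a⁻ x) = 0) : a⁻ x = 0 := by
  rw [← inner_self_eq_zero (𝕜 := ℂ), inner_negPart_left, h, inner_zero_right]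

theorem isNegativeOn_range_negPart {a : K →L[ℂ] K} (ha : IsSelfAdjoint a) :
    IsNegativeOn a (a⁻).range := by
  rintro _ ⟨x, rfl⟩ hx
  have h1 := re_inner_apply_nonneg (CFC.negPart_nonneg a) (a⁻ x)
  have h2 : (⟪a⁻ (a⁻ x), a⁻ x⟫_ℂ).re ≠ 0 := fun h0 ↦
    hx (negPart_negPart_eq_zero (ker_of_inner_eq_zero (CFC.negPart_nonneg a) h0))
  change (⟪a (a⁻ x), a⁻ x⟫_ℂ).re < 0
  rw [negPart_comp_apply_negPart ha, inner_neg_left, Complex.neg_re]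
  exact neg_neg_of_pos (lt_of_le_of_ne h1 h2.symm)

/-- The range of a⁻ is itself negative, and on the kernel of a⁻ the form of a is that of a⁺. -/
theorem negIndex_eq_finrank_range_negPart {a : K →L[ℂ] K} (ha : IsSelfAdjoint a)
    [FiniteDimensional ℂ (a⁻).range] : negIndex a = Module.finrank ℂ (a⁻).range := by
  refine le_antisymm (negIndex_le_rank_range a⁻ fun f hf ↦ ?_)
    (isNegativeOn_range_negPart ha).finrank_le_negIndex
  have h1 : a f = a⁺ f := by
    conv_lhs => rw [← CFC.posPart_sub_negPart a ha]
    simp [hf]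
  rw [h1]
  exact re_inner_apply_nonneg (CFC.posPart_nonneg a) f

theorem exists_signature {a : K →L[ℂ] K} (ha : IsSelfAdjoint a) (hfin : negIndex a < ⊤) :
    ∃ p P, Signature a p P := by
  have hF : FiniteDimensional ℂ (a⁻).range :=
    (isNegativeOn_range_negPart ha).finiteDimensional hfin
  set N := a⁻ with hN
  set P : K →L[ℂ] K := N.range.starProjection with hP
  have habs : modulus a = CFC.abs a := rfl
  have habs0 : 0 ≤ CFC.abs a := CFC.abs_nonneg a
  set p := CFC.sqrt (CFC.abs a) with hp
  have hPN : P * N = N := by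
    ext x
    exact Submodule.starProjection_eq_self_iff.2 ⟨x, rfl⟩
  have hPs : IsSelfAdjoint P := isSelfAdjoint_starProjection _
  have hNs : IsSelfAdjoint N := IsSelfAdjoint.of_nonneg (CFC.negPart_nonneg a)
  have hNP : N * P = N := by
    have := congrArg star hPN
    rwa [star_mul, hPs.star_eq, hNs.star_eq] at this
  have hpos : a⁺ * P = 0 := by
    ext x
    obtain ⟨y, hy⟩ := Submodule.starProjection_apply_mem N.range x
    change a⁺ (P x) = 0
    rw [hP, ← hy]
    exact congrArg (fun T : K →L[ℂ] K ↦ T y) (CFC.posPart_mul_negPart a)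
  have hpos' : P * a⁺ = 0 := by
    have := congrArg star hpos
    rwa [star_mul, hPs.star_eq, (IsSelfAdjoint.of_nonneg (CFC.posPart_nonneg a)).star_eq,
      star_zero] at this
  have habs' : CFC.abs a = a⁺ + N := (CFC.posPart_add_negPart a ha).symm
  -- P kills a⁺ and fixes N on both sides, so it commutes with |a| = a⁺ + N, hence with its square
  -- root.
  have hcomm : Commute P (CFC.abs a) := by
    rw [habs', Commute, SemiconjBy, mul_add, add_mul, hpos, hpos', hPN, hNP]
  have hcommp : Commute P p := by
    have := (Commute.cfcₙ_nnreal hcomm.symm NNReal.sqrt).symm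
    exact this
  have hsq : p * p = CFC.abs a := CFC.sqrt_mul_sqrt_self _ habs0
  have hps : IsSelfAdjoint p := IsSelfAdjoint.of_nonneg (CFC.sqrt_nonneg _)
  have hPP : P * P = P := N.range.isIdempotentElem_starProjection
  have hrange : P.range = N.range := Submodule.range_starProjection _
  refine ⟨p, P, hps.isSymmetric, hPs.isSymmetric, fun x ↦ congrArg (fun T : K →L[ℂ] K ↦ T x) hPP,
    fun x ↦ congrArg (fun T : K →L[ℂ] K ↦ T x) hcommp.eq,
    fun x ↦ congrArg (fun T : K →L[ℂ] K ↦ T x) hsq, fun x ↦ ?_, hrange ▸ hF,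
    hrange ▸ negIndex_eq_finrank_range_negPart ha, ?_⟩
  · have h1 : a = p * p - (2 : ℂ) • (p * (P * p)) := by
      rw [hcommp.eq, ← mul_assoc, hsq, habs', add_mul, hpos, hNP, zero_add, two_smul]
      conv_lhs => rw [← CFC.posPart_sub_negPart a ha]
      abel
    exact congrArg (fun T : K →L[ℂ] K ↦ T x) h1
  -- On the range of N the root p is injective: p y = 0 gives |a| y = 0, so N y = 0. Finite
  -- dimension turns this into a lower bound, the gap δ.
  · have hinj : ((p : K →ₗ[ℂ] K) ∘ₗ N.range.subtype).ker = ⊥ := by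
      rw [LinearMap.ker_eq_bot']
      rintro ⟨_, y, rfl⟩ hy
      have h1 : p (N y) = 0 := hy
      have h2 : N (N y) = 0 := by
        have h3 : CFC.abs a (N y) = 0 := by
          rw [← hsq]; change p (p (N y)) = 0; rw [h1, map_zero]
        have h4 : a⁺ (N y) = 0 :=
          congrArg (fun T : K →L[ℂ] K ↦ T y) (CFC.posPart_mul_negPart a)
        rw [habs'] at h3
        simpa [h4] using h3
      exact Subtype.ext (negPart_negPart_eq_zero h2)
    obtain ⟨C, hC, hl⟩ := LinearMap.exists_antilipschitzWith _ hinj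
    have hC' : (0 : ℝ) < C := hC
    refine ⟨1 / (C : ℝ) ^ 2, by positivity, fun x ↦ ?_⟩
    have h1 := hl.le_mul_dist ⟨P x, Submodule.starProjection_apply_mem N.range x⟩ 0
    rw [map_zero, dist_zero_right, dist_zero_right] at h1
    have h2 : ‖P x‖ ≤ C * ‖p (P x)‖ := h1
    rw [one_div, inv_mul_le_iff₀ (by positivity), ← mul_pow]
    gcongr

end Signature

section NegIndex

variable {E : Type*} [NormedAddCommGroup E] [InnerProductSpace ℂ E]

theorem negIndex_mono {A B : E →L[ℂ] E} {c : ℝ} (hc : 0 < c)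
    (h : ∀ x, (⟪B x, x⟫_ℂ).re ≤ c * (⟪A x, x⟫_ℂ).re) : negIndex A ≤ negIndex B :=
  iSup₂_le fun _ hL ↦ IsNegativeOn.toENat_rank_le_negIndex fun f hf hf0 ↦
    (h f).trans_lt (mul_neg_of_pos_of_neg hc (hL f hf hf0))

end NegIndex

/-! ### Estimates from the factorization -/

section Signature

variable {K : Type*} [NormedAddCommGroup K] [InnerProductSpace ℂ K] [CompleteSpace K]

namespace Signature

variable {a p P : K →L[ℂ] K}

theorem re_inner_modulus (s : Signature a p P) (x : K) :
    (⟪modulus a x, x⟫_ℂ).re = ‖p x‖ ^ 2 := by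
  rw [← s.sq, s.symm_root, ← RCLike.re_eq_complex_re, inner_self_eq_norm_sq]

theorem inner_eq (s : Signature a p P) (x y : K) :
    ⟪a x, y⟫_ℂ = ⟪p x, p y⟫_ℂ - 2 * ⟪P (p x), P (p y)⟫_ℂ := by
  rw [s.fac, inner_sub_left, inner_smul_left, s.symm_root, s.symm_root (P (p x)),
    ← s.symm_proj (P (p x)), s.idem,
    map_ofNat]

theorem re_inner (s : Signature a p P) (x : K) :
    (⟪a x, x⟫_ℂ).re = ‖p x‖ ^ 2 - 2 * ‖P (p x)‖ ^ 2 := by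
  rw [s.inner_eq, Complex.sub_re, ← inner_self_eq_norm_sq (𝕜 := ℂ) (p x),
    ← inner_self_eq_norm_sq (𝕜 := ℂ) (P (p x))]
  simp

theorem inner_sub_proj (s : Signature a p P) (x y : K) :
    ⟪x - P x, P y⟫_ℂ = 0 := by
  rw [← s.symm_proj, map_sub, s.idem, sub_self, inner_zero_left]

theorem norm_sq_eq (s : Signature a p P) (x : K) :
    ‖x‖ ^ 2 = ‖x - P x‖ ^ 2 + ‖P x‖ ^ 2 := by
  have h := norm_add_sq_eq_norm_sq_add_norm_sq_of_inner_eq_zero _ _ (s.inner_sub_proj x x)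
  rw [sub_add_cancel] at h
  rw [pow_two, pow_two, pow_two]
  exact h

theorem norm_root_sq_eq (s : Signature a p P) (x : K) :
    ‖p x‖ ^ 2 = ‖p (x - P x)‖ ^ 2 + ‖p (P x)‖ ^ 2 := by
  rw [s.norm_sq_eq (p x), s.comm, map_sub]

theorem norm_reflection (s : Signature a p P) (x : K) :
    ‖x - (2 : ℂ) • P x‖ = ‖x‖ := by
  have h : P (x - (2 : ℂ) • P x) = - P x := by
    rw [map_sub, map_smul, s.idem, two_smul]; abel
  have h1 := s.norm_sq_eq (x - (2 : ℂ) • P x)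
  rw [h, norm_neg, two_smul] at h1
  have h2 : x - (P x + P x) - -P x = x - P x := by abel
  rw [h2, ← s.norm_sq_eq, ← two_smul ℂ] at h1
  exact (sq_eq_sq₀ (norm_nonneg _) (norm_nonneg _)).1 h1

/-- Cauchy–Schwarz for the indefinite form: (a x, y) = (J p x, p y), where J = 1 − 2P is isometric.
-/
theorem norm_inner_le (s : Signature a p P) (x y : K) :
    ‖⟪a x, y⟫_ℂ‖ ≤ ‖p x‖ * ‖p y‖ := by
  have h : ⟪a x, y⟫_ℂ = ⟪p x - (2 : ℂ) • P (p x), p y⟫_ℂ := by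
    rw [s.fac, ← map_smul p, ← map_sub, s.symm_root]
  rw [h, ← s.norm_reflection (p x)]
  exact norm_inner_le_norm _ _

theorem proj_eq_self (s : Signature a p P) {r : K} (hr : r ∈ P.range) : P r = r := by
  obtain ⟨y, rfl⟩ := hr
  exact s.idem y

theorem exists_re_inner_le (s : Signature a p P) :
    ∃ δ > 0, ∀ r ∈ P.range, (⟪a r, r⟫_ℂ).re ≤ -(δ * ‖r‖ ^ 2) := by
  obtain ⟨δ, hδ, h⟩ := s.gap
  refine ⟨δ, hδ, fun r hr ↦ ?_⟩
  have h1 := h r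
  rw [s.proj_eq_self hr] at h1
  rw [s.re_inner, s.comm, s.proj_eq_self hr]
  linarith

theorem isNegativeOn (s : Signature a p P) : IsNegativeOn a P.range := by
  obtain ⟨δ, hδ, h⟩ := s.exists_re_inner_le
  intro r hr hr0
  have : 0 < δ * ‖r‖ ^ 2 := by positivity
  linarith [h r hr]

/-- The form of |a| exceeds that of a by 2‖P p x‖², and the gap bounds δ‖P p x‖² by ‖p P p x‖² = ‖P
a x‖². Hence convergence of a x and of (a x, x) controls |a|^{1/2} x. -/
theorem exists_norm_root_sq_le (s : Signature a p P) :
    ∃ c, 0 ≤ c ∧ ∀ x, ‖p x‖ ^ 2 ≤ (⟪a x, x⟫_ℂ).re + c * ‖a x‖ ^ 2 := by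
  obtain ⟨δ, hδ, h⟩ := s.gap
  refine ⟨2 / δ, by positivity, fun x ↦ ?_⟩
  have h1 : P (a x) = - p (P (p x)) := by
    rw [s.fac, two_smul]
    simp only [map_sub, map_add, s.comm, s.idem]
    abel
  have h2 := h (p x)
  have h3 := s.norm_sq_eq (a x)
  rw [h1, norm_neg] at h3
  rw [s.re_inner]
  have h4 : ‖P (p x)‖ ^ 2 ≤ ‖a x‖ ^ 2 / δ := by
    rw [le_div_iff₀ hδ]
    nlinarith [sq_nonneg ‖a x - -p (P (p x))‖]
  have h5 : 2 / δ * ‖a x‖ ^ 2 = 2 * (‖a x‖ ^ 2 / δ) := by ring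
  linarith

end Signature

/-- If `D = m - b* b` has at most as many negative squares as `m`, then
`‖b x‖² ≤ c (|m| x, x)`. -/
theorem exists_norm_sq_le_modulus {F : Type*} [NormedAddCommGroup F] [InnerProductSpace ℂ F]
    {m D : K →L[ℂ] K} {b : K →L[ℂ] F} (hm : IsSelfAdjoint m) (hfin : negIndex m < ⊤)
    (hD : ∀ x, (⟪D x, x⟫_ℂ).re = (⟪m x, x⟫_ℂ).re - ‖b x‖ ^ 2) (hle : negIndex D ≤ negIndex m) :
    ∃ c, 0 ≤ c ∧ ∀ x, ‖b x‖ ^ 2 ≤ c * (⟪modulus m x, x⟫_ℂ).re := by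
  obtain ⟨p, P, s⟩ := exists_signature hm hfin
  obtain ⟨δ, hδ, hgap⟩ := s.gap
  have := s.fin
  have hneg : IsNegativeOn D P.range := fun r hr hr0 ↦ by
    have := s.isNegativeOn r hr hr0
    rw [hD]
    nlinarith [sq_nonneg ‖b r‖]
  refine ⟨3 * (1 + ‖b‖ ^ 2 / δ), by positivity, fun x ↦ ?_⟩
  -- The range of P is a maximal D-negative subspace, so some k + r is D-nonnegative: ‖b(k + r)‖² +
  -- ‖p r‖² ≤ ‖p k‖². The rest of b x lives on the range of P, where the gap applies.
  obtain ⟨r, hr, h0⟩ := hneg.exists_nonneg (hle.trans s.finrank_eq.le) (x - P x)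
  have hPr := s.proj_eq_self hr
  set k := x - P x with hk
  have hPk : P k = 0 := by rw [hk, map_sub, s.idem, sub_self]
  have hPkr : P (k + r) = r := by rw [map_add, hPk, hPr, zero_add]
  rw [hD, s.re_inner, s.norm_root_sq_eq (k + r), s.comm, hPkr, add_sub_cancel_right] at h0
  have hr2 := hgap r
  rw [hPr] at hr2
  have hx2 := hgap x
  rw [s.re_inner_modulus, s.norm_root_sq_eq x, ← hk]
  have hb : ‖b x‖ ≤ ‖b (k + r)‖ + ‖b‖ * ‖r‖ + ‖b‖ * ‖P x‖ := by
    have h1 : b x = b (k + r) - b r + b (P x) := by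
      rw [← map_sub, ← map_add, hk]; congr 1; abel
    rw [h1]
    exact (norm_add_le _ _).trans (add_le_add ((norm_sub_le _ _).trans
      (add_le_add le_rfl (b.le_opNorm _))) (b.le_opNorm _))
  have hsq : ‖b x‖ ^ 2 ≤ 3 * (‖b (k + r)‖ ^ 2 + ‖b‖ ^ 2 * ‖r‖ ^ 2 + ‖b‖ ^ 2 * ‖P x‖ ^ 2) := by
    have h1 : ‖b x‖ ^ 2 ≤ (‖b (k + r)‖ + ‖b‖ * ‖r‖ + ‖b‖ * ‖P x‖) ^ 2 := by gcongr
    nlinarith [sq_nonneg (‖b (k + r)‖ - ‖b‖ * ‖r‖), sq_nonneg (‖b (k + r)‖ - ‖b‖ * ‖P x‖),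
      sq_nonneg (‖b‖ * ‖r‖ - ‖b‖ * ‖P x‖)]
  have h3 : ‖b‖ ^ 2 * ‖r‖ ^ 2 ≤ ‖b‖ ^ 2 / δ * ‖p r‖ ^ 2 := by
    rw [div_mul_eq_mul_div, le_div_iff₀ hδ, mul_assoc]
    gcongr
    linarith
  have h4 : ‖b‖ ^ 2 * ‖P x‖ ^ 2 ≤ ‖b‖ ^ 2 / δ * ‖p (P x)‖ ^ 2 := by
    rw [div_mul_eq_mul_div, le_div_iff₀ hδ, mul_assoc]
    gcongr
    linarith
  have h5 : 0 ≤ ‖b‖ ^ 2 / δ := by positivity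
  have h6 : ‖b‖ ^ 2 / δ * ‖p r‖ ^ 2 ≤ ‖b‖ ^ 2 / δ * ‖p k‖ ^ 2 := by
    refine mul_le_mul_of_nonneg_left ?_ h5
    nlinarith [sq_nonneg ‖b (k + r)‖]
  nlinarith [sq_nonneg ‖p r‖, sq_nonneg ‖p (P x)‖]

/-- The modulus of `a (2 - a)` is dominated by the modulus of `a`. -/
theorem exists_modulus_mul_le {a : K →L[ℂ] K} (ha : IsSelfAdjoint a) :
    ∃ c, 0 ≤ c ∧
      ∀ x, (⟪modulus (a * (2 - a)) x, x⟫_ℂ).re ≤ c * (⟪modulus a x, x⟫_ℂ).re := by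
  have h2 : IsSelfAdjoint (2 - a) := (IsSelfAdjoint.ofNat (R := K →L[ℂ] K) 2).sub ha
  have hc : Commute a (2 - a) := (Commute.ofNat_right a 2).sub_right (Commute.refl a)
  have hc' : Commute a (star (2 - a)) := h2.star_eq.symm ▸ hc
  have h3 : modulus (a * (2 - a)) = CFC.abs a * CFC.abs (2 - a) := hc.cfcAbs_mul_eq hc'
  have h4 : Commute (CFC.abs a) (CFC.abs (2 - a)) := hc.cfcAbs_cfcAbs hc'
  set c := ‖CFC.abs (2 - a)‖
  have h5 : CFC.abs (2 - a) ≤ algebraMap ℝ (K →L[ℂ] K) c :=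
    (IsSelfAdjoint.of_nonneg (CFC.abs_nonneg (2 - a))).le_algebraMap_norm_self
  -- As |a(2 − a)| = |a| |2 − a|, the claim is nonnegativity of a product of commuting nonnegative
  -- operators.
  have h6 : 0 ≤ CFC.abs a * (algebraMap ℝ (K →L[ℂ] K) c - CFC.abs (2 - a)) :=
    Commute.mul_nonneg (CFC.abs_nonneg a) (sub_nonneg.2 h5)
      ((Algebra.commute_algebraMap_right c _).sub_right h4)
  refine ⟨c, norm_nonneg _, fun x ↦ ?_⟩
  have h7 := re_inner_apply_nonneg h6 x
  rw [mul_sub, ← h3, ← Algebra.commutes, ← Algebra.smul_def] at h7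
  change 0 ≤ (⟪(c • modulus a - modulus (a * (2 - a)) : K →L[ℂ] K) x, x⟫_ℂ).re at h7
  have h8 : ⟪(c • modulus a) x, x⟫_ℂ = c * ⟪modulus a x, x⟫_ℂ := by
    change ⟪c • modulus a x, x⟫_ℂ = _
    rw [inner_smul_left_eq_smul]
    simp
  rw [sub_apply, inner_sub_left, h8, Complex.sub_re,
    Complex.re_ofReal_mul] at h7
  linarith

end Signature

/-! ### Douglas factorization -/

section Douglas

variable {K F : Type*} [NormedAddCommGroup K] [InnerProductSpace ℂ K] [CompleteSpace K]
  [NormedAddCommGroup F] [InnerProductSpace ℂ F] [CompleteSpace F]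

/-- Douglas factorization: if `‖b x‖ ≤ c ‖p x‖`, then `b = R p` for a bounded operator `R` that
vanishes on the orthogonal complement of the range of `p`. -/
theorem exists_comp_eq_of_norm_le (p : K →L[ℂ] K) (b : K →L[ℂ] F) {c : ℝ}
    (h : ∀ x, ‖b x‖ ≤ c * ‖p x‖) :
    ∃ R : K →L[ℂ] F, (∀ x, R (p x) = b x) ∧ ∀ y ∈ p.rangeᗮ, R y = 0 := by
  set Z := p.range.topologicalClosure with hZ
  have hpZ : ∀ x, p x ∈ Z := fun x ↦ p.range.le_topologicalClosure ⟨x, rfl⟩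
  have : CompleteSpace Z := p.range.isClosed_topologicalClosure.completeSpace_coe
  let e : K →ₗ[ℂ] Z := (p : K →ₗ[ℂ] K).codRestrict Z hpZ
  have hdense : DenseRange e := by
    intro z
    obtain ⟨w, hw, hlim⟩ := mem_closure_iff_seq_limit.1 (show (z : K) ∈ closure p.range from z.2)
    choose v hv using hw
    refine mem_closure_iff_seq_limit.2 ⟨fun n ↦ e (v n), fun n ↦ ⟨v n, rfl⟩, ?_⟩
    rw [tendsto_subtype_rng]
    simpa [e, hv] using hlim
  -- The map p x ↦ b x extends by continuity to the closure of the range of p, and by zero to its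
  -- complement.
  refine ⟨(b : K →ₗ[ℂ] F).extendOfNorm e ∘L Z.orthogonalProjectionOnto, fun x ↦ ?_, fun y hy ↦ ?_⟩
  · have h1 : Z.orthogonalProjectionOnto (p x) = e x :=
      Submodule.orthogonalProjectionOnto_mem_subspace_eq_self (⟨p x, hpZ x⟩ : Z)
    rw [ContinuousLinearMap.comp_apply, h1]
    exact LinearMap.extendOfNorm_eq hdense ⟨c, h⟩ x
  · have h1 : y ∈ Zᗮ := by rwa [hZ, Submodule.orthogonal_closure]
    rw [ContinuousLinearMap.comp_apply, Submodule.orthogonalProjectionOnto_apply_of_mem_orthogonal h1,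
      map_zero]

theorem adjoint_apply_mem_closure_range {p : K →L[ℂ] K} {R : K →L[ℂ] F}
    (h : ∀ y ∈ p.rangeᗮ, R y = 0) (ψ : F) : R.adjoint ψ ∈ closure (p.range : Set K) := by
  have h1 : R.adjoint ψ ∈ p.rangeᗮᗮ := by
    intro y hy
    rw [ContinuousLinearMap.adjoint_inner_right, h y hy, inner_zero_left]
  rwa [Submodule.orthogonal_orthogonal_eq_closure] at h1

end Douglas

/-! ### The smallest completion -/

section Vanishing

variable {H : Type*} [NormedAddCommGroup H] [InnerProductSpace ℂ H] [CompleteSpace H]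
  {H₁ : Submodule ℂ H}

theorem inner_add_of_vanishing {Y : H →L[ℂ] H} (hY : IsSelfAdjoint Y) (h0 : ∀ f : H₁, Y f = 0)
    (f : H₁) (ψ : H) : ⟪Y (f + ψ), f + ψ⟫_ℂ = ⟪Y ψ, ψ⟫_ℂ := by
  have h1 : ⟪Y ψ, (f : H)⟫_ℂ = 0 := by
    rw [show ⟪Y ψ, (f : H)⟫_ℂ = ⟪ψ, Y f⟫_ℂ from hY.isSymmetric ψ f, h0, inner_zero_right]
  rw [map_add, h0, zero_add, inner_add_right, h1, zero_add]

end Vanishing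

section Extension

variable {H : Type*} [NormedAddCommGroup H] [InnerProductSpace ℂ H]
  {H₁ : Submodule ℂ H} [CompleteSpace H₁]

theorem inner_corner_left (C : H₁ →L[ℂ] H) (f g : H₁) : ⟪corner C f, g⟫_ℂ = ⟪C f, (g : H)⟫_ℂ :=
  Submodule.inner_orthogonalProjectionOnto_eq_of_mem_right g (C f)

/-- The form of `A` and `A` itself become arbitrarily small along `𝔥₁ + ψ`, for each `ψ` orthogonal
to `𝔥₁`: the shorted operator of `A` vanishes. -/
def HasNullSequences (H₁ : Submodule ℂ H) (A : H →L[ℂ] H) : Prop :=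
  ∀ ψ ∈ H₁ᗮ, ∃ u : ℕ → H₁, Tendsto (fun n ↦ A (u n + ψ)) atTop (𝓝 0) ∧
    Tendsto (fun n ↦ (⟪A (u n + ψ), u n + ψ⟫_ℂ).re) atTop (𝓝 0)

variable [CompleteSpace H]

/-- The negative subspace of the corner is already maximal for any other solution A', so each x = uₙ
+ ψ has a correction r in it with (A'(x + r), x + r) ≥ 0. Uniform negativity on that subspace makes
the gain from r at most ‖A x‖²/δ, which vanishes in the limit and leaves ((A' − A)ψ, ψ) ≥ 0. -/
theorem isLeast_of_hasNullSequences {C : H₁ →L[ℂ] H} {A : H →L[ℂ] H}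
    (hC : IsSelfAdjoint (corner C)) (hfin : negIndex (corner C) < ⊤)
    (hA : A ∈ completions C) (hnull : HasNullSequences H₁ A) : IsLeast (completions C) A := by
  refine ⟨hA, fun A' hA' ↦ ?_⟩
  obtain ⟨p, P, s⟩ := exists_signature hC hfin
  have := s.fin
  obtain ⟨δ, hδ, hgap⟩ := s.exists_re_inner_le
  obtain ⟨hAs, hAC, -⟩ := hA
  obtain ⟨hAs', hAC', hidx⟩ := hA'
  set L := P.range.map H₁.subtype with hL
  have hneg : IsNegativeOn A' L := by
    rintro _ ⟨r, hr, rfl⟩ hr0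
    change (⟪A' r, (r : H)⟫_ℂ).re < 0
    rw [hAC', ← inner_corner_left]
    exact s.isNegativeOn r hr (by simpa using hr0)
  have hdim : negIndex A' ≤ Module.finrank ℂ L := by
    rw [hidx, s.finrank_eq, hL, Submodule.finrank_map_subtype_eq]
  set Y := A' - A with hYdef
  have hYs : IsSelfAdjoint Y := hAs'.sub hAs
  have hY0 : ∀ f : H₁, Y f = 0 := fun f ↦ by rw [hYdef, sub_apply, hAC, hAC', sub_self]
  have key : ∀ ψ ∈ H₁ᗮ, 0 ≤ (⟪Y ψ, ψ⟫_ℂ).re := by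
    intro ψ hψ
    obtain ⟨u, hu, hu'⟩ := hnull ψ hψ
    have hlim : Tendsto (fun n ↦ (⟪A (u n + ψ), u n + ψ⟫_ℂ).re + (⟪Y ψ, ψ⟫_ℂ).re +
        ‖A (u n + ψ)‖ ^ 2 / δ) atTop (𝓝 (⟪Y ψ, ψ⟫_ℂ).re) := by
      have := (hu'.add_const (⟪Y ψ, ψ⟫_ℂ).re).add ((hu.norm.pow 2).div_const δ)
      simpa using this
    refine ge_of_tendsto' hlim fun n ↦ ?_
    set x : H := u n + ψ with hx
    obtain ⟨_, ⟨r, hr, rfl⟩, h0⟩ := hneg.exists_nonneg hdim x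
    change 0 ≤ (⟪A' (x + r), x + (r : H)⟫_ℂ).re at h0
    have hA'x : A' x = A x + Y x := by rw [hYdef, sub_apply]; abel
    have h1 : ⟪A' x, x⟫_ℂ = ⟪A x, x⟫_ℂ + ⟪Y ψ, ψ⟫_ℂ := by
      rw [hA'x, inner_add_left, hx, inner_add_of_vanishing hYs hY0]
    have h2 : ⟪A' x, (r : H)⟫_ℂ = ⟪A x, (r : H)⟫_ℂ := by
      rw [show ⟪A' x, (r : H)⟫_ℂ = ⟪x, A' r⟫_ℂ from hAs'.isSymmetric x r,
        show ⟪A x, (r : H)⟫_ℂ = ⟪x, A r⟫_ℂ from hAs.isSymmetric x r, hAC, hAC']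
    have h3 : (⟪A' r, x⟫_ℂ).re = (⟪A x, (r : H)⟫_ℂ).re := by
      rw [show ⟪A' r, x⟫_ℂ = ⟪(r : H), A' x⟫_ℂ from hAs'.isSymmetric r x,
        ← inner_conj_symm, Complex.conj_re, h2]
    have h4 : (⟪A' r, (r : H)⟫_ℂ).re ≤ -(δ * ‖r‖ ^ 2) := by
      rw [hAC', ← inner_corner_left]
      exact hgap r hr
    have h5 : (⟪A x, (r : H)⟫_ℂ).re ≤ ‖A x‖ * ‖r‖ :=
      (Complex.re_le_norm _).trans (norm_inner_le_norm _ _)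
    rw [map_add, inner_add_left, inner_add_right _ x, inner_add_right _ x, h1, h2, Complex.add_re,
      Complex.add_re, Complex.add_re, Complex.add_re, h3] at h0
    have h6 : 2 * (‖A x‖ * ‖r‖) - δ * ‖r‖ ^ 2 ≤ ‖A x‖ ^ 2 / δ := by
      rw [le_div_iff₀ hδ]
      nlinarith [sq_nonneg (‖A x‖ - δ * ‖r‖)]
    linarith
  rw [ContinuousLinearMap.le_def, ContinuousLinearMap.isPositive_def']
  refine ⟨hYs, fun x ↦ ?_⟩
  have h1 := inner_add_of_vanishing hYs hY0 (H₁.orthogonalProjectionOnto x)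
    (x - H₁.orthogonalProjectionOnto x)
  rw [add_sub_cancel] at h1
  change 0 ≤ (⟪Y x, x⟫_ℂ).re
  rw [h1]
  exact key _ (H₁.sub_starProjection_mem_orthogonal x)

/-- With b = Rp the column is (pJp, Rp), and J² = 1 makes it the first column of G*JG for G = (p,
JR*). The negative squares number at most the rank of P. -/
theorem exists_completion_hasNullSequences {C : H₁ →L[ℂ] H} (hC : IsSelfAdjoint (corner C))
    (hfin : negIndex (corner C) < ⊤) {c : ℝ}
    (hb : ∀ f, ‖C f - corner C f‖ ^ 2 ≤ c * (⟪modulus (corner C) f, f⟫_ℂ).re) :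
    ∃ A ∈ completions C, HasNullSequences H₁ A := by
  obtain ⟨p, P, s⟩ := exists_signature hC hfin
  have := s.fin
  set b : H₁ →L[ℂ] H₁ᗮ := H₁ᗮ.orthogonalProjectionOnto ∘L C with hbdef
  have hbC : ∀ f, (b f : H) = C f - corner C f := fun f ↦
    Submodule.starProjection_orthogonal_val (K := H₁) (C f)
  have hbp : ∀ f, ‖b f‖ ≤ Real.sqrt (max c 0) * ‖p f‖ := by
    intro f
    refine (sq_le_sq₀ (norm_nonneg _) (by positivity)).1 ?_
    rw [mul_pow, Real.sq_sqrt (le_max_right _ _), Submodule.coe_norm, hbC]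
    refine (hb f).trans ?_
    rw [s.re_inner_modulus]
    exact mul_le_mul_of_nonneg_right (le_max_left _ _) (by positivity)
  obtain ⟨R, hR, hR0⟩ := exists_comp_eq_of_norm_le p b hbp
  set J : H₁ →L[ℂ] H₁ := 1 - (2 : ℂ) • P with hJ
  have hJx : ∀ x, J x = x - (2 : ℂ) • P x := fun x ↦ rfl
  have hJs : ∀ x y, ⟪J x, y⟫_ℂ = ⟪x, J y⟫_ℂ := fun x y ↦ by
    rw [hJx, hJx, inner_sub_left, inner_sub_right, inner_smul_left, inner_smul_right,
      s.symm_proj, map_ofNat]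
  have hJJ : ∀ x, J (J x) = x := fun x ↦ by
    rw [hJx (J x), hJx x, map_sub, map_smul, s.idem]
    simp only [two_smul]
    abel
  have hJp : ∀ x, J (p x) = p (J x) := fun x ↦ by
    rw [hJx, hJx, map_sub, map_smul, s.comm]
  have hfac : ∀ x, p (J (p x)) = corner C x := fun x ↦ by
    rw [hJx, map_sub, map_smul, s.fac]
  set G : H →L[ℂ] H₁ := p ∘L H₁.orthogonalProjectionOnto +
    J ∘L R.adjoint ∘L H₁ᗮ.orthogonalProjectionOnto with hG
  have hG1 : ∀ f : H₁, G f = p f := by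
    intro f
    have h1 : H₁ᗮ.orthogonalProjectionOnto (f : H) = 0 :=
      Submodule.orthogonalProjectionOnto_apply_of_mem_orthogonal
        (H₁.le_orthogonal_orthogonal f.2)
    have h2 : H₁.orthogonalProjectionOnto (f : H) = f :=
      Submodule.orthogonalProjectionOnto_mem_subspace_eq_self f
    simp [hG, h1, h2]
  have hG2 : ∀ ψ : H₁ᗮ, G ψ = J (R.adjoint ψ) := by
    intro ψ
    have h1 : H₁ᗮ.orthogonalProjectionOnto (ψ : H) = ψ :=
      Submodule.orthogonalProjectionOnto_mem_subspace_eq_self ψ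
    have h2 : H₁.orthogonalProjectionOnto (ψ : H) = 0 :=
      Submodule.orthogonalProjectionOnto_apply_of_mem_orthogonal ψ.2
    simp [hG, h1, h2]
  set A : H →L[ℂ] H := G.adjoint ∘L J ∘L G with hAdef
  have hAin : ∀ x y, ⟪A x, y⟫_ℂ = ⟪J (G x), G y⟫_ℂ := fun x y ↦
    ContinuousLinearMap.adjoint_inner_left G y (J (G x))
  have hAs : IsSelfAdjoint A := by
    rw [ContinuousLinearMap.isSelfAdjoint_iff_isSymmetric]
    intro x y
    change ⟪A x, y⟫_ℂ = ⟪x, A y⟫_ℂ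
    rw [hAin, ← inner_conj_symm x, hAin, inner_conj_symm, hJs]
  have hAC : ∀ f : H₁, A f = C f := by
    intro f
    refine ext_inner_right ℂ fun y ↦ ?_
    have hy : G y = p (H₁.orthogonalProjectionOnto y) +
      J (R.adjoint (H₁ᗮ.orthogonalProjectionOnto y)) := rfl
    rw [hAin, hG1, hy, inner_add_right, ← s.symm_root, hfac, ← hJs, hJJ,
      ContinuousLinearMap.adjoint_inner_right, hR, Submodule.coe_inner, Submodule.coe_inner H₁ᗮ, hbC,
      Submodule.coe_orthogonalProjectionOnto_apply, Submodule.coe_orthogonalProjectionOnto_apply]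
    have h1 : ⟪C f - corner C f, H₁.starProjection y⟫_ℂ = 0 :=
      H₁.starProjection_inner_eq_zero (C f) _ (H₁.starProjection_apply_mem y)
    have h2 : ⟪(corner C f : H), H₁ᗮ.starProjection y⟫_ℂ = 0 :=
      H₁ᗮ.starProjection_apply_mem y _ (corner C f).2
    rw [inner_sub_left, sub_eq_zero] at h1
    rw [inner_sub_left, h2, sub_zero, ← h1, ← inner_add_right,
      Submodule.starProjection_add_starProjection_orthogonal]
  have hle : negIndex A ≤ negIndex (corner C) := by
    have hfd : FiniteDimensional ℂ (P ∘L G).range :=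
      Submodule.finiteDimensional_of_le (S₂ := P.range) (LinearMap.range_comp_le_range _ _)
    refine (negIndex_le_rank_range (P ∘L G) fun x hx ↦ ?_).trans ?_
    · have hx' : P (G x) = 0 := hx
      rw [hAin, hJx, hx', smul_zero, sub_zero, ← RCLike.re_eq_complex_re, inner_self_eq_norm_sq]
      positivity
    · rw [s.finrank_eq]
      exact_mod_cast Submodule.finrank_mono (LinearMap.range_comp_le_range _ _)
  have hge : negIndex (corner C) ≤ negIndex A := by
    have hneg : IsNegativeOn A (P.range.map H₁.subtype) := by
      rintro _ ⟨r, hr, rfl⟩ hr0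
      change (⟪A r, (r : H)⟫_ℂ).re < 0
      rw [hAC, ← inner_corner_left]
      exact s.isNegativeOn r hr (by simpa using hr0)
    have := hneg.finrank_le_negIndex
    rwa [Submodule.finrank_map_subtype_eq, ← s.finrank_eq] at this
  refine ⟨A, ⟨hAs, hAC, le_antisymm hle hge⟩, fun ψ hψ ↦ ?_⟩
  -- If p vₙ → R*ψ, then G(−J vₙ + ψ) = J(R*ψ − p vₙ) → 0.
  obtain ⟨w, hw, hlim⟩ := mem_closure_iff_seq_limit.1
    (adjoint_apply_mem_closure_range hR0 (⟨ψ, hψ⟩ : H₁ᗮ))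
  choose v hv using hw
  have hGlim : Tendsto (fun n ↦ G (((-J (v n) : H₁) : H) + ψ)) atTop (𝓝 0) := by
    have h1 : ∀ n, G (((-J (v n) : H₁) : H) + ψ) = J (R.adjoint ⟨ψ, hψ⟩ - w n) := fun n ↦ by
      rw [map_add, hG1, hG2 ⟨ψ, hψ⟩, map_neg, ← hJp, map_sub, ← hv n]
      exact neg_add_eq_sub _ _
    simp only [h1]
    have h2 := (J.continuous.tendsto _).comp (hlim.const_sub (R.adjoint ⟨ψ, hψ⟩))
    rw [sub_self, map_zero] at h2
    exact h2
  refine ⟨fun n ↦ -J (v n), ?_, ?_⟩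
  · have h2 := ((G.adjoint ∘L J).continuous.tendsto _).comp hGlim
    rw [map_zero] at h2
    exact h2
  · have h2 : Continuous fun z : H₁ ↦ (⟪J z, z⟫_ℂ).re := by fun_prop
    have h3 := (h2.tendsto _).comp hGlim
    rw [map_zero, inner_zero_left, Complex.zero_re] at h3
    simp only [hAin]
    exact h3

end Extension

/-! ### Pairs of extensions and the uniqueness criterion -/

section ExtensionPair

variable {H : Type*} [NormedAddCommGroup H] [InnerProductSpace ℂ H] {H₁ : Submodule ℂ H}

theorem IsSymmetricOn.neg {T₁ : H₁ →L[ℂ] H} (h : IsSymmetricOn T₁) : IsSymmetricOn (-T₁) :=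
  fun f g ↦ by simp only [neg_apply, inner_neg_left, inner_neg_right, h f g]

variable [CompleteSpace H]

/-- A pair of bounded selfadjoint extensions of `T₁`. -/
structure ExtensionPair (T₁ : H₁ →L[ℂ] H) (T T' : H →L[ℂ] H) : Prop where
  left_selfAdjoint : IsSelfAdjoint T
  right_selfAdjoint : IsSelfAdjoint T'
  left_apply : ∀ f : H₁, T f = T₁ f
  right_apply : ∀ f : H₁, T' f = T₁ f

namespace ExtensionPair

variable {T₁ : H₁ →L[ℂ] H} {T T' : H →L[ℂ] H}

theorem sub_apply_coe (h : ExtensionPair T₁ T T') (f : H₁) : (T' - T) f = 0 := by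
  rw [sub_apply, h.left_apply, h.right_apply, sub_self]

theorem sub_apply_mem_orthogonal (h : ExtensionPair T₁ T T') (x : H) : (T' - T) x ∈ H₁ᗮ := by
  intro f hf
  have h1 : ⟪f, (T' - T) x⟫_ℂ = ⟪(T' - T) f, x⟫_ℂ :=
    ((h.right_selfAdjoint.sub h.left_selfAdjoint).isSymmetric f x).symm
  rw [h1, h.sub_apply_coe ⟨f, hf⟩, inner_zero_left]

theorem sub_eq (h : ExtensionPair T₁ T T') (f d : H₁) (ψ : H) :
    (1 + T) ((f + d : H₁) + ψ) - (1 - T') ((f - d : H₁) + -ψ) =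
      (2 : ℂ) • (T₁ f + (d + ψ)) - (T' - T) ψ := by
  change _ + ψ + T (_ + ψ) - (_ + -ψ - T' (_ + -ψ)) = _
  rw [map_add T, map_add T', h.left_apply, h.right_apply, map_neg, map_add, map_sub, sub_apply,
    two_smul, Submodule.coe_add, Submodule.coe_sub]
  abel

end ExtensionPair

end ExtensionPair

section Extension

variable {H : Type*} [NormedAddCommGroup H] [InnerProductSpace ℂ H]
  {H₁ : Submodule ℂ H} [CompleteSpace H₁]

theorem IsSymmetricOn.isSelfAdjoint_corner {T₁ : H₁ →L[ℂ] H} (h : IsSymmetricOn T₁) :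
    IsSelfAdjoint (corner T₁) := by
  rw [ContinuousLinearMap.isSelfAdjoint_iff_isSymmetric]
  intro f g
  change ⟪corner T₁ f, g⟫_ℂ = ⟪f, corner T₁ g⟫_ℂ
  rw [inner_corner_left, h, ← inner_conj_symm f, inner_corner_left, inner_conj_symm]

theorem corner_neg (T₁ : H₁ →L[ℂ] H) : corner (-T₁) = -corner T₁ := by
  ext f; simp [corner]

theorem corner_subtypeL_add (T₁ : H₁ →L[ℂ] H) : corner (H₁.subtypeL + T₁) = 1 + corner T₁ := by
  ext f; simp [corner]

theorem norm_sq_eq_corner_add (T₁ : H₁ →L[ℂ] H) (f : H₁) :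
    ‖T₁ f‖ ^ 2 = ‖corner T₁ f‖ ^ 2 + ‖T₁ f - corner T₁ f‖ ^ 2 := by
  have h0 : ⟪T₁ f - corner T₁ f, (corner T₁ f : H)⟫_ℂ = 0 :=
    H₁.starProjection_inner_eq_zero (T₁ f) _ (corner T₁ f).2
  have h := norm_add_sq_eq_norm_sq_add_norm_sq_of_inner_eq_zero _ _ h0
  rw [sub_add_cancel, ← pow_two, ← pow_two, ← pow_two] at h
  rw [h, add_comm, Submodule.coe_norm]

variable [CompleteSpace H]

theorem defect_apply (T₁ : H₁ →L[ℂ] H) (f : H₁) : defect T₁ f = f - T₁.adjoint (T₁ f) := rfl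

theorem defect_neg (T₁ : H₁ →L[ℂ] H) : defect (-T₁) = defect T₁ := by
  ext f; simp [defect]

theorem isSelfAdjoint_defect (T₁ : H₁ →L[ℂ] H) : IsSelfAdjoint (defect T₁) := by
  rw [ContinuousLinearMap.isSelfAdjoint_iff_isSymmetric]
  intro f g
  change ⟪defect T₁ f, g⟫_ℂ = ⟪f, defect T₁ g⟫_ℂ
  rw [defect_apply, defect_apply, inner_sub_left, inner_sub_right,
    ContinuousLinearMap.adjoint_inner_left, ContinuousLinearMap.adjoint_inner_right]

theorem re_inner_defect (T₁ : H₁ →L[ℂ] H) (f : H₁) :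
    (⟪defect T₁ f, f⟫_ℂ).re = ‖f‖ ^ 2 - ‖T₁ f‖ ^ 2 := by
  rw [defect_apply, inner_sub_left, ContinuousLinearMap.adjoint_inner_left, Complex.sub_re,
    ← inner_self_eq_norm_sq (𝕜 := ℂ) f, ← inner_self_eq_norm_sq (𝕜 := ℂ) (T₁ f)]
  rfl

/-- Solvability of the completion problem for `(I + T₁₁, T₂₁*; T₂₁, *)`. -/
theorem exists_completion_one_add {T₁ : H₁ →L[ℂ] H} (hsymm : IsSymmetricOn T₁)
    (hquasi : negIndex (defect T₁) < ⊤)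
    (hindex : negIndex (1 - corner T₁ ∘L corner T₁) = negIndex (defect T₁)) :
    ∃ A, IsLeast (completions (H₁.subtypeL + T₁)) A ∧ HasNullSequences H₁ A := by
  set t := corner T₁ with ht
  have hts : IsSelfAdjoint t := hsymm.isSelfAdjoint_corner
  have htsymm : ∀ x y, ⟪t x, y⟫_ℂ = ⟪x, t y⟫_ℂ := hts.isSymmetric
  set m : H₁ →L[ℂ] H₁ := 1 - t ∘L t with hm
  have hmt : m = (1 + t) * (2 - (1 + t)) := by
    change 1 - t * t = _
    rw [← one_add_one_eq_two, add_sub_add_left_eq_sub]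
    rw [mul_sub, mul_one, add_mul, one_mul]
    abel
  have has : IsSelfAdjoint (1 + t) := IsSelfAdjoint.add (R := H₁ →L[ℂ] H₁) (.one _) hts
  have hms : IsSelfAdjoint m :=
    IsSelfAdjoint.sub (R := H₁ →L[ℂ] H₁) (.one _)
      (show IsSelfAdjoint (t * t) from pow_two t ▸ IsSelfAdjoint.pow (R := H₁ →L[ℂ] H₁) hts 2)
  have hmre : ∀ x, (⟪m x, x⟫_ℂ).re = ‖x‖ ^ 2 - ‖t x‖ ^ 2 := fun x ↦ by
    change (⟪x - t (t x), x⟫_ℂ).re = _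
    rw [inner_sub_left, htsymm, Complex.sub_re, ← inner_self_eq_norm_sq (𝕜 := ℂ) x,
      ← inner_self_eq_norm_sq (𝕜 := ℂ) (t x)]
    rfl
  have hfin : negIndex m < ⊤ := hindex ▸ hquasi
  set b : H₁ →L[ℂ] H := T₁ - H₁.subtypeL ∘L t with hb
  have hbx : ∀ x, b x = T₁ x - t x := fun x ↦ rfl
  obtain ⟨c, hc, hbc⟩ := exists_norm_sq_le_modulus (b := b) hms hfin (D := defect T₁) (fun x ↦ by
    rw [re_inner_defect, hmre, norm_sq_eq_corner_add, hbx]; ring) hindex.ge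
  obtain ⟨c', hc', hmod⟩ := exists_modulus_mul_le has
  rw [← hmt] at hmod
  have hcorner := corner_subtypeL_add T₁
  have hCs : IsSelfAdjoint (corner (H₁.subtypeL + T₁)) := hcorner ▸ has
  have hCfin : negIndex (corner (H₁.subtypeL + T₁)) < ⊤ := by
    rw [hcorner]
    -- 2(1 + t) − (1 − t²) = (1 + t)² ≥ 0.
    refine (negIndex_mono (B := m) two_pos fun x ↦ ?_).trans_lt hfin
    have h1 : (⟪(1 + t) x, x⟫_ℂ).re = ‖x‖ ^ 2 + (⟪t x, x⟫_ℂ).re := by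
      change (⟪x + t x, x⟫_ℂ).re = _
      rw [inner_add_left, Complex.add_re, ← inner_self_eq_norm_sq (𝕜 := ℂ) x]
      rfl
    have h2 := norm_add_sq (𝕜 := ℂ) (t x) x
    rw [RCLike.re_eq_complex_re] at h2
    change _ ≤ 2 * (⟪(1 + t) x, x⟫_ℂ).re
    rw [h1, hmre]
    nlinarith [sq_nonneg ‖t x + x‖]
  obtain ⟨A, hA, hnull⟩ := exists_completion_hasNullSequences hCs hCfin (c := c * c') fun f ↦ by
    have h1 : (H₁.subtypeL + T₁) f - corner (H₁.subtypeL + T₁) f = b f := by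
      rw [hcorner, hbx]
      change (f : H) + T₁ f - ((f + t f : H₁) : H) = _
      rw [Submodule.coe_add]
      abel
    rw [h1, mul_assoc, hcorner]
    exact (hbc f).trans (mul_le_mul_of_nonneg_left (hmod f) hc)
  exact ⟨A, isLeast_of_hasNullSequences hCs hCfin hA hnull, hnull⟩

theorem kreinSup_eq_top_iff (T₁ : H₁ →L[ℂ] H) (φ : H) :
    kreinSup T₁ φ = ⊤ ↔
      ¬ ∃ c, 0 ≤ c ∧ ∀ f, ‖⟪T₁ f, φ⟫_ℂ‖ ^ 2 ≤ c * (⟪modulus (defect T₁) f, f⟫_ℂ).re := by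
  have hpos : ∀ f, 0 ≤ (⟪modulus (defect T₁) f, f⟫_ℂ).re :=
    re_inner_apply_nonneg (CFC.sqrt_nonneg _)
  rw [← not_iff_not, not_not, ← ne_eq, ← lt_top_iff_ne_top]
  constructor
  · intro h
    refine ⟨(kreinSup T₁ φ).toReal, ENNReal.toReal_nonneg, fun f ↦ ?_⟩
    have h1 : ENNReal.ofReal (‖⟪T₁ f, φ⟫_ℂ‖ ^ 2) /
        ENNReal.ofReal (⟪modulus (defect T₁) f, f⟫_ℂ).re ≤ kreinSup T₁ φ :=
      le_iSup (fun f : H₁ ↦ ENNReal.ofReal (‖⟪T₁ f, φ⟫_ℂ‖ ^ 2) /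
        ENNReal.ofReal (⟪modulus (defect T₁) f, f⟫_ℂ).re) f
    rw [ENNReal.div_le_iff_le_mul (Or.inr h.ne) (Or.inl ENNReal.ofReal_ne_top),
      ← ENNReal.ofReal_toReal h.ne, ← ENNReal.ofReal_mul ENNReal.toReal_nonneg,
      ENNReal.ofReal_le_ofReal_iff (mul_nonneg ENNReal.toReal_nonneg (hpos f))] at h1
    exact h1
  · rintro ⟨c, hc, h⟩
    refine (iSup_le fun f ↦ ?_).trans_lt (ENNReal.ofReal_lt_top (r := c))
    rw [ENNReal.div_le_iff_le_mul (Or.inr ENNReal.ofReal_ne_top) (Or.inl ENNReal.ofReal_ne_top),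
      ← ENNReal.ofReal_mul hc]
    exact ENNReal.ofReal_le_ofReal (h f)

theorem adjoint_apply_of_extension {T₁ : H₁ →L[ℂ] H} {T : H →L[ℂ] H} (hT : IsSelfAdjoint T)
    (hT₁ : ∀ f : H₁, T f = T₁ f) (x : H) :
    H₁.orthogonalProjectionOnto (T x) = T₁.adjoint x := by
  refine ext_inner_right ℂ fun f ↦ ?_
  rw [Submodule.inner_orthogonalProjectionOnto_eq_of_mem_right,
    ContinuousLinearMap.adjoint_inner_left, ← hT₁]
  exact hT.isSymmetric x f

namespace ExtensionPair

variable {T₁ : H₁ →L[ℂ] H} {T T' : H →L[ℂ] H}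

theorem orthogonalProjectionOnto_add (h : ExtensionPair T₁ T T') (f d : H₁) (ψ : H) :
    H₁.orthogonalProjectionOnto ((1 + T) ((f + d : H₁) + ψ) + (1 - T') ((f - d : H₁) + -ψ)) =
      (2 : ℂ) • (f + T₁.adjoint (d + ψ)) := by
  have h1 : (1 + T) ((f + d : H₁) + ψ) + (1 - T') ((f - d : H₁) + -ψ) =
      ((2 : ℂ) • f : H₁) + (T ((f + d : H₁) + ψ) - T' ((f - d : H₁) + -ψ)) := by
    change _ + ψ + T (_ + ψ) + (_ + -ψ - T' (_ + -ψ)) = _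
    rw [Submodule.coe_smul, two_smul, Submodule.coe_add, Submodule.coe_sub]
    abel
  have h2 : (((f + d : H₁) : H) + ψ) - ((f - d : H₁) + -ψ) = (2 : ℂ) • ((d : H) + ψ) := by
    rw [two_smul, Submodule.coe_add, Submodule.coe_sub]
    abel
  rw [h1, map_add, map_sub, adjoint_apply_of_extension h.left_selfAdjoint h.left_apply,
    adjoint_apply_of_extension h.right_selfAdjoint h.right_apply, ← map_sub, h2, map_smul,
    Submodule.orthogonalProjectionOnto_mem_subspace_eq_self, smul_add]

theorem re_inner_add (h : ExtensionPair T₁ T T') (f d : H₁) (ψ : H) :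
    (⟪(1 + T) ((f + d : H₁) + ψ), (f + d : H₁) + ψ⟫_ℂ).re +
      (⟪(1 - T') ((f - d : H₁) + -ψ), (f - d : H₁) + -ψ⟫_ℂ).re =
      2 * (⟪defect T₁ f, f⟫_ℂ).re + 2 * ‖T₁ f + (d + ψ)‖ ^ 2 - (⟪(T' - T) ψ, ψ⟫_ℂ).re := by
  have h1 := h.orthogonalProjectionOnto_add f d ψ
  have h2 := h.sub_eq f d ψ
  set X := (1 + T) ((f + d : H₁) + ψ)
  set Y := (1 - T') ((f - d : H₁) + -ψ)
  set s : H := d + ψ with hs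
  have hx : ((f + d : H₁) : H) + ψ = f + s := by rw [Submodule.coe_add, hs]; abel
  have hy : ((f - d : H₁) : H) + -ψ = f - s := by rw [Submodule.coe_sub, hs]; abel
  have h3 : ⟪X, (f : H) + s⟫_ℂ + ⟪Y, (f : H) - s⟫_ℂ = ⟪X + Y, (f : H)⟫_ℂ + ⟪X - Y, s⟫_ℂ := by
    rw [inner_add_left, inner_sub_left, inner_add_right, inner_sub_right]
    ring
  have h4 : ⟪X + Y, (f : H)⟫_ℂ = 2 * (⟪f, f⟫_ℂ + ⟪s, T₁ f⟫_ℂ) := by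
    rw [← Submodule.inner_orthogonalProjectionOnto_eq_of_mem_right, h1, inner_smul_left,
      inner_add_left, ContinuousLinearMap.adjoint_inner_left, map_ofNat]
  have h5 : ⟪(T' - T) ψ, s⟫_ℂ = ⟪(T' - T) ψ, ψ⟫_ℂ := by
    rw [hs, inner_add_right, Submodule.inner_left_of_mem_orthogonal d.2
      (h.sub_apply_mem_orthogonal ψ), zero_add]
  have h6 : ⟪X - Y, s⟫_ℂ = 2 * (⟪T₁ f, s⟫_ℂ + ⟪s, s⟫_ℂ) - ⟪(T' - T) ψ, ψ⟫_ℂ := by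
    rw [h2, inner_sub_left, h5, inner_smul_left, inner_add_left, map_ofNat]
  have h7 := norm_add_sq (𝕜 := ℂ) (T₁ f) s
  rw [RCLike.re_eq_complex_re] at h7
  have h8 : (⟪s, T₁ f⟫_ℂ).re = (⟪T₁ f, s⟫_ℂ).re := inner_re_symm (𝕜 := ℂ) s (T₁ f)
  have h9 : (⟪f, f⟫_ℂ).re = ‖f‖ ^ 2 := inner_self_eq_norm_sq (𝕜 := ℂ) f
  have h10 : (⟪s, s⟫_ℂ).re = ‖s‖ ^ 2 := inner_self_eq_norm_sq (𝕜 := ℂ) s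
  have h11 (z : ℂ) : (2 * z).re = 2 * z.re := by simp
  rw [hx, hy, ← Complex.add_re, h3, h4, h6, re_inner_defect, h7, Complex.add_re, Complex.sub_re,
    h11, h11, Complex.add_re, Complex.add_re, h8, h9, h10]
  ring

/-- Null sequences of `1 + T` and `1 - T'` combine to a sequence along which the column of
`1 - T₁* T₁` is controlled by `T' - T`. -/
theorem exists_sequence (h : ExtensionPair T₁ T T') (hT : HasNullSequences H₁ (1 + T))
    (hT' : HasNullSequences H₁ (1 - T')) {ψ : H} (hψ : ψ ∈ H₁ᗮ) :
    ∃ f : ℕ → H₁,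
      (∀ φ ∈ H₁ᗮ, Tendsto (fun n ↦ ⟪T₁ (f n), φ⟫_ℂ) atTop
        (𝓝 ⟪(2⁻¹ : ℂ) • (T' - T) ψ - ψ, φ⟫_ℂ)) ∧
      Tendsto (fun n ↦ defect T₁ (f n)) atTop
        (𝓝 (-(T₁.adjoint ((2⁻¹ : ℂ) • (T' - T) ψ)))) ∧
      Tendsto (fun n ↦ (⟪defect T₁ (f n), f n⟫_ℂ).re) atTop
        (𝓝 (2⁻¹ * (⟪(T' - T) ψ, ψ⟫_ℂ).re - ‖(2⁻¹ : ℂ) • (T' - T) ψ‖ ^ 2)) := by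
  obtain ⟨u, hu, hu'⟩ := hT ψ hψ
  obtain ⟨v, hv, hv'⟩ := hT' (-ψ) (neg_mem hψ)
  -- Half-sum and half-difference of the two sequences; in the sum, ψ and −ψ cancel.
  set f : ℕ → H₁ := fun n ↦ (2⁻¹ : ℂ) • (u n + v n) with hf
  set d : ℕ → H₁ := fun n ↦ (2⁻¹ : ℂ) • (u n - v n) with hd
  have huf : ∀ n, u n = f n + d n := fun n ↦ by
    rw [hf, hd]; module
  have hvf : ∀ n, v n = f n - d n := fun n ↦ by
    rw [hf, hd]; module
  simp only [huf] at hu hu'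
  simp only [hvf] at hv hv'
  set w := (2⁻¹ : ℂ) • (T' - T) ψ with hw
  have hg : Tendsto (fun n ↦ T₁ (f n) + (d n + ψ)) atTop (𝓝 w) := by
    have h1 := ((hu.sub hv).const_smul (2⁻¹ : ℂ)).add_const w
    simp only [h.sub_eq] at h1
    rw [sub_zero, smul_zero, zero_add] at h1
    refine h1.congr fun n ↦ ?_
    rw [hw]; module
  have hDlim : Tendsto (fun n ↦ defect T₁ (f n)) atTop (𝓝 (-(T₁.adjoint w))) := by
    have h1 := ((H₁.orthogonalProjectionOnto.continuous.tendsto _).comp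
      (hu.add hv)).const_smul (2⁻¹ : ℂ)
    -- D f = (f + T₁*(d + ψ)) − T₁*(T₁f + d + ψ): the first term tends to 0, the second to T₁*w.
    have h2 := h1.sub ((T₁.adjoint.continuous.tendsto _).comp hg)
    rw [add_zero, map_zero, smul_zero, zero_sub] at h2
    refine h2.congr fun n ↦ ?_
    simp only [Function.comp_apply]
    rw [h.orthogonalProjectionOnto_add, smul_smul, inv_mul_cancel₀ two_ne_zero, one_smul,
      map_add T₁.adjoint (T₁ (f n)), defect_apply]
    abel
  refine ⟨f, fun φ hφ ↦ ?_, hDlim, ?_⟩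
  · have h1 : Tendsto (fun n ↦ ⟪T₁ (f n) + (d n + ψ) - ψ, φ⟫_ℂ) atTop (𝓝 ⟪w - ψ, φ⟫_ℂ) :=
      (hg.sub_const ψ).inner tendsto_const_nhds
    refine h1.congr fun n ↦ ?_
    rw [← add_assoc, add_sub_cancel_right, inner_add_left,
      Submodule.inner_right_of_mem_orthogonal (d n).2 hφ, add_zero]
  · have h1 := (hu'.add hv').add_const (⟪(T' - T) ψ, ψ⟫_ℂ).re
    simp only [h.re_inner_add] at h1
    have h2 := (h1.const_mul (2⁻¹ : ℝ)).sub (hg.norm.pow 2)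
    rw [add_zero, zero_add] at h2
    refine h2.congr fun n ↦ ?_
    ring

theorem eq_iff_kreinSup (h : ExtensionPair T₁ T T') (hT : HasNullSequences H₁ (1 + T))
    (hT' : HasNullSequences H₁ (1 - T')) (hquasi : negIndex (defect T₁) < ⊤) :
    T = T' ↔ ∀ φ ∈ H₁ᗮ, φ ≠ 0 → kreinSup T₁ φ = ⊤ := by
  obtain ⟨p, P, s⟩ := exists_signature (isSelfAdjoint_defect T₁) hquasi
  obtain ⟨K, hK, hpK⟩ := s.exists_norm_root_sq_le
  simp only [kreinSup_eq_top_iff, s.re_inner_modulus]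
  constructor
  · rintro rfl φ hφ hφ0 ⟨c, hc, hb⟩
    obtain ⟨f, h1, h2, h3⟩ := h.exists_sequence hT hT' hφ
    have h1' := (h1 φ hφ).norm.pow 2
    simp only [sub_self, zero_apply, smul_zero, zero_sub, inner_zero_left, Complex.zero_re,
      mul_zero, norm_zero, map_zero, neg_zero] at h1' h2 h3
    have h4 := (h3.add ((h2.norm.pow 2).const_mul K)).const_mul c
    -- Here w = 0, so a finite constant c would give ‖(φ, φ)‖² ≤ 0.
    have h5 := le_of_tendsto_of_tendsto' h1' h4 fun n ↦
      (hb (f n)).trans (mul_le_mul_of_nonneg_left (hpK (f n)) hc)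
    simp only [inner_neg_left, norm_neg, norm_zero] at h5
    have h6 : 0 < ‖⟪φ, φ⟫_ℂ‖ := norm_pos_iff.2 (inner_self_ne_zero.2 hφ0)
    nlinarith
  · intro hkrein
    have hW : ∀ ψ ∈ H₁ᗮ, (T' - T) ψ = 0 := by
      intro ψ hψ
      by_contra hne
      refine hkrein _ (h.sub_apply_mem_orthogonal ψ) hne ?_
      obtain ⟨f, -, h2, h3⟩ := h.exists_sequence hT hT' hψ
      set w := (2⁻¹ : ℂ) • (T' - T) ψ with hw
      have hw2 : (T' - T) ψ = (2 : ℂ) • w := by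
        rw [hw, smul_smul, mul_inv_cancel₀ two_ne_zero, one_smul]
      have hlim := h3.add ((h2.norm.pow 2).const_mul K)
      set B := 2⁻¹ * (⟪(T' - T) ψ, ψ⟫_ℂ).re - ‖w‖ ^ 2 + K * ‖-T₁.adjoint w‖ ^ 2
      have hB : 0 ≤ B := ge_of_tendsto' hlim fun n ↦ (sq_nonneg _).trans (hpK (f n))
      -- B is the limit of the bounds on ‖p fₙ‖²; the factor 4 comes from testing with (T' − T)ψ =
      -- 2w.
      refine ⟨4 * B, by positivity, fun g ↦ ?_⟩
      have h4 : Tendsto (fun n ↦ ‖⟪defect T₁ (f n), g⟫_ℂ‖ ^ 2) atTop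
          (𝓝 (‖⟪-T₁.adjoint w, g⟫_ℂ‖ ^ 2)) :=
        (h2.inner tendsto_const_nhds).norm.pow 2
      have h5 : ‖⟪-T₁.adjoint w, g⟫_ℂ‖ ^ 2 ≤ B * ‖p g‖ ^ 2 := by
        refine le_of_tendsto_of_tendsto' h4 (hlim.mul_const (‖p g‖ ^ 2)) fun n ↦ ?_
        calc ‖⟪defect T₁ (f n), g⟫_ℂ‖ ^ 2 ≤ (‖p (f n)‖ * ‖p g‖) ^ 2 := by
              gcongr; exact s.norm_inner_le _ _
          _ = ‖p (f n)‖ ^ 2 * ‖p g‖ ^ 2 := mul_pow _ _ _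
          _ ≤ _ := by gcongr; exact hpK (f n)
      rw [inner_neg_left, norm_neg, ContinuousLinearMap.adjoint_inner_left, norm_inner_symm] at h5
      have h6 : ‖(2 : ℂ)‖ = 2 := RCLike.norm_ofNat 2
      rw [hw2, inner_smul_right, norm_mul, mul_pow, h6]
      linarith
    ext x
    have h1 : (T' - T) x = 0 := by
      rw [← H₁.starProjection_add_starProjection_orthogonal x, map_add,
        h.sub_apply_coe ⟨_, H₁.starProjection_apply_mem x⟩,
        hW _ (H₁ᗮ.starProjection_apply_mem x), add_zero]
    exact (sub_eq_zero.1 h1).symm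

end ExtensionPair

end Extension

theorem theorem6p9 {H : Type*} [NormedAddCommGroup H] [InnerProductSpace ℂ H] [CompleteSpace H]
    (H₁ : Submodule ℂ H) [CompleteSpace H₁] (T₁ : H₁ →L[ℂ] H)
    (hsymm : IsSymmetricOn T₁)
    (hquasi : negIndex (defect T₁) < ⊤)
    (hindex : negIndex (1 - corner T₁ ∘L corner T₁) = negIndex (defect T₁)) :
    (∃ Tm : H →L[ℂ] H, IsMinimalExtension T₁ Tm) ∧
    (∃ TM : H →L[ℂ] H, IsMaximalExtension T₁ TM) ∧
    ∀ Tm TM : H →L[ℂ] H, IsMinimalExtension T₁ Tm → IsMaximalExtension T₁ TM →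
      (Tm = TM ↔ ∀ φ ∈ H₁ᗮ, φ ≠ 0 → kreinSup T₁ φ = ⊤) := by
  obtain ⟨A, hA, hAnull⟩ := exists_completion_one_add hsymm hquasi hindex
  -- I − T₁*T₁ and I − T₁₁² do not change under T₁ ↦ −T₁.
  obtain ⟨B, hB, hBnull⟩ := exists_completion_one_add hsymm.neg (by rwa [defect_neg])
    (by rw [corner_neg, defect_neg, ← hindex]; congr 1; ext; simp)
  rw [← sub_eq_add_neg] at hB
  refine ⟨⟨A - 1, ?_⟩, ⟨1 - B, ?_⟩, fun Tm TM hm hM ↦ ?_⟩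
  · rwa [IsMinimalExtension, add_sub_cancel]
  · rwa [IsMaximalExtension, sub_sub_cancel]
  -- Least elements are unique, so the null sequences of the constructed solutions serve any Tm and
  -- TM.
  · have hAm : 1 + Tm = A := hm.unique hA
    have hBM : 1 - TM = B := hM.unique hB
    refine ExtensionPair.eq_iff_kreinSup ⟨?_, ?_, fun f ↦ ?_, fun f ↦ ?_⟩ (hAm ▸ hAnull)
      (hBM ▸ hBnull) hquasi
    · have := hm.1.1.sub (IsSelfAdjoint.one (H →L[ℂ] H))
      rwa [add_sub_cancel_left] at this
    · have := (IsSelfAdjoint.one (H →L[ℂ] H)).sub hM.1.1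
      rwa [sub_sub_cancel] at this
    · exact add_left_cancel (hm.1.2.1 f)
    · exact sub_right_injective (hM.1.2.1 f)
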